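/- **Setting.** There are $M$ users, $N$ options, and time steps $t=1,2,\dots$. In each step every user chooses $K$ options. User $i$ obtains from option $j$ in step $m$ a reward $X^i_j(m)\in[0,1]$ with mean $\mu^i_j$. For each $(i,j)$ the rewards are identically distributed in $m$. The reward vector $(X^i_j(m))_{i,j}$ of step $m$ is independent of everything that happened before step $m$ and of the choices of step $m$; within one step the rewards may depend on each other. For every user $i$ the means $\mu^i_1,\dots,\mu^i_N$ are pairwise distinct. The users are divided into $G$ groups. Group $l$ has a known preferred set $N^l_K$ of $K$ options, different groups have different preferred sets, and for every user $i$ of group $l$ the set $N^l_K$ is the set of the $K$ options with the largest means $\mu^i_j$. **Algorithm D\_PART.** Let $n^i_j(t)$ be the number of steps $m\le t$ in which user $i$ chose option $j$, and $r^i_j(t)$ the average of the rewards that user $i$ obtained from option $j$ in these steps. *Classification.* After step $t$, let $\tilde N^i_K(t)$ be a set of $K$ options whose counts $n^i_j(t)$ are among the $K$ highest of user $i$. User $i$ is assigned to a group $g_i(t)\in\arg\max_{l}|\tilde N^i_K(t)\cap N^l_K|$. *Choice.* Fix $\alpha\in\mathbb R$. Put $\omega^{i,k}=1$ if $g_i(t)=g_k(t)$.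 Otherwise $\omega^{i,k}<1$ is a fixed real number that may depend on $i,k$ and on the groups $g_i(t),g_k(t)$. Put $$\beta^i_j(t)=\frac{\sum_{k}(n^k_j(t))^{\omega^{i,k}}}{\sum_{m=1}^N\sum_{k}(n^k_m(t))^{\omega^{i,k}}}$$ (with $0^0=1$ and $0^x=0$ for real $x\ne0$). In step $t+1$ user $i$ chooses $K$ options whose indices $$r^i_j(t)-\alpha\,(1-\beta^i_j(t))\sqrt{\frac{\log t}{t}}+\sqrt{\frac{2\log t}{n^i_j(t)}}$$ are among the $K$ highest; an option with $n^i_j(t)=0$ has index $+\infty$. All ties are broken arbitrarily, possibly at random, but without knowledge of future rewards. **Theorem.** There is a constant $C_1>0$, depending only on the setting ($M,N,K,G$, the means, the groups and their preferred sets), on $\alpha$ and on the weights, such that for every user $j$, with true group $r$, and for every $t\ge 2$, $$P\big(g_j(t)\neq r\big)\le C_1\,\frac{\log t}{t}.$$ -/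

import Mathlib

open MeasureTheory ProbabilityTheory

namespace GroupLearning

noncomputable section

/-- `S` consists of `K` elements whose `f`-values are among the `K` highest
(when values tie at the boundary there may be several such sets). -/
def IsTopK {ι β : Type*} [Preorder β] (K : ℕ) (f : ι → β) (S : Finset ι) : Prop :=
  S.card = K ∧ ∀ x ∈ S, ∀ y ∉ S, f y ≤ f x

/-- The diverse-preference setting: `M` users, `N` options, `K` choices per step, `G` groups. -/
structure DiverseSetting (M N K G : ℕ) where
  /-- mean reward of option `j` for user `i` -/
  mean : Fin M → Fin N → ℝ
  /-- different options have distinct mean rewards for a user -/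
  mean_injective : ∀ i, Function.Injective (mean i)
  /-- the true preference group of each user -/
  group : Fin M → Fin G
  /-- the (known) `K`-preferred set of each group -/
  pref : Fin G → Finset (Fin N)
  pref_card : ∀ l, (pref l).card = K
  /-- preferred sets differ from group to group -/
  pref_injective : Function.Injective pref
  /-- the preferred set of a user's group is the set of the user's top `K` options -/
  isTopK_pref : ∀ i, IsTopK K (mean i) (pref (group i))

variable {M N K G : ℕ}

/-- The reward vectors `X · · m`, `m = 1, 2, …`: for every user and option the rewards are in
`[0, 1]`, identically distributed in time with the prescribed mean, and the reward vector of step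
`t + 1` is independent of all information `ℱ t` available after step `t`. Rewards of different
users or options in the same step may depend on each other. -/
structure IsRewardProcess {Ω : Type*} {mΩ : MeasurableSpace Ω} (S : DiverseSetting M N K G)
    (P : Measure Ω) (ℱ : Filtration ℕ mΩ) (X : Fin M → Fin N → ℕ → Ω → ℝ) : Prop where
  measurable : ∀ i j t, 1 ≤ t → Measurable[ℱ t] (X i j t)
  mem_Icc : ∀ i j t, 1 ≤ t → ∀ᵐ ω ∂P, X i j t ω ∈ Set.Icc (0 : ℝ) 1
  identDistrib : ∀ i j t, 1 ≤ t → IdentDistrib (X i j t) (X i j 1) P P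
  mean_eq : ∀ i j, ∫ ω, X i j 1 ω ∂P = S.mean i j
  indep : ∀ t, Indep (MeasurableSpace.comap (fun ω i j => X i j (t + 1) ω) inferInstance) (ℱ t) P

/-- `n^i_j(t)`: the number of steps `1 ≤ m ≤ t` in which user `i` chose option `j`. -/
def count (a : Fin M → ℕ → Finset (Fin N)) (i : Fin M) (j : Fin N) (t : ℕ) : ℕ :=
  ((Finset.Icc 1 t).filter (fun m => j ∈ a i m)).card

/-- `r^i_j(t)`: the sample mean of the rewards user `i` itself collected from option `j`. -/
def sampleMean (a : Fin M → ℕ → Finset (Fin N)) (x : Fin M → Fin N → ℕ → ℝ)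
    (i : Fin M) (j : Fin N) (t : ℕ) : ℝ :=
  (∑ m ∈ (Finset.Icc 1 t).filter (fun m => j ∈ a i m), x i j m) / (count a i j t : ℝ)

/-- The weight `ω^{i,k}`, given the current classification `g`: it is `1` if `i` and `k` are
classified to the same group, and otherwise a discount factor, possibly depending on the two
groups. -/
def weight (disc : Fin M → Fin M → Fin G → Fin G → ℝ) (g : Fin M → Fin G) (i k : Fin M) : ℝ :=
  if g k = g i then 1 else disc i k (g i) (g k)

/-- `β^i_j(t)`: the weighted group recommendation for option `j` as seen by user `i`. -/
def recommendation (disc : Fin M → Fin M → Fin G → Fin G → ℝ) (a : Fin M → ℕ → Finset (Fin N))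
    (g : Fin M → Fin G) (i : Fin M) (j : Fin N) (t : ℕ) : ℝ :=
  (∑ k, (count a k j t : ℝ) ^ weight disc g i k) /
    ∑ m, ∑ k, (count a k m t : ℝ) ^ weight disc g i k

/-- The D_PART index of option `j` for user `i` after step `t`; an option that the user has never
tried has index `∞`. -/
def dPartIndex (α : ℝ) (disc : Fin M → Fin M → Fin G → Fin G → ℝ)
    (a : Fin M → ℕ → Finset (Fin N)) (x : Fin M → Fin N → ℕ → ℝ) (g : Fin M → Fin G)
    (i : Fin M) (t : ℕ) (j : Fin N) : EReal :=
  if count a i j t = 0 then ⊤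
  else ((sampleMean a x i j t
      - α * (1 - recommendation disc a g i j t) * √(Real.log t / t)
      + √(2 * Real.log t / count a i j t) : ℝ) : EReal)

/-- The classification rule: `l` maximises the overlap of its preferred set with some set `T` of
`K` most frequently used options, `n j` being the number of uses of option `j`. -/
def IsAssignedGroup (S : DiverseSetting M N K G) (n : Fin N → ℕ) (l : Fin G) : Prop :=
  ∃ T : Finset (Fin N), IsTopK K n T ∧
    ∀ l' : Fin G, (T ∩ S.pref l').card ≤ (T ∩ S.pref l).card

/-- `a` (choices) and `g` (classification) are an execution of D_PART on the rewards `X`. All ties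
are broken arbitrarily, possibly at random, but without looking at future rewards: the choices of
step `t + 1` and the classification after step `t` are determined by the information `ℱ t`, which
may contain extra randomness. -/
structure IsDPartRun {Ω : Type*} {mΩ : MeasurableSpace Ω} (S : DiverseSetting M N K G)
    (α : ℝ) (disc : Fin M → Fin M → Fin G → Fin G → ℝ)
    (ℱ : Filtration ℕ mΩ) (X : Fin M → Fin N → ℕ → Ω → ℝ)
    (a : Fin M → ℕ → Ω → Finset (Fin N)) (g : Fin M → ℕ → Ω → Fin G) : Prop where
  /-- choices do not anticipate -/
  measurable_choice : ∀ i t (A : Finset (Fin N)), MeasurableSet[ℱ t] {ω | a i (t + 1) ω = A}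
  /-- classifications do not anticipate -/
  measurable_class : ∀ i t (l : Fin G), MeasurableSet[ℱ t] {ω | g i t ω = l}
  /-- at step `t + 1` each user chooses `K` options of highest index -/
  choice : ∀ i t ω, IsTopK K
    (dPartIndex α disc (fun k m => a k m ω) (fun k j m => X k j m ω) (fun k => g k t ω) i t)
    (a i (t + 1) ω)
  /-- after step `t` each user is classified by its most frequent choices -/
  classify : ∀ i t ω, IsAssignedGroup S (fun j => count (fun k m => a k m ω) i j t) (g i t ω)

end

end GroupLearning

namespace GroupLearning

variable {M N K G : ℕ}

/-! A misclassification at time t is a sign of at least t/2 choices of wrong options, whereas a UCB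
rule makes only O(log t) such choices in expectation. Markov's inequality then gives O(log t / t).

The first half is combinatorial (`le_two_mul_sum_count_of_ne`). For the second, β lies in [0,1], so
the recommendation term is at most |α|√(log s / s) and eventually falls below any fraction δ of the
gap between preferred and other options. From then on, a wrong option already tried about 2 log t /
δ² times is chosen again only if some sample mean leaves its confidence interval
(`exists_deviation_of_mem`).

Such a deviation at time s has probability at most 2/s³ per option (`measureReal_badEvent_le`), by
an exponential supermartingale that copes with adaptive choices. These probabilities are summable,
so the deviations add only a constant to the expected number of wrong choices. -/

lemma count_zero (a : Fin M → ℕ → Finset (Fin N)) (i : Fin M) (j : Fin N) :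
    count a i j 0 = 0 := by
  simp [count]

lemma filter_Icc_succ (p : ℕ → Prop) [DecidablePred p] (t : ℕ) :
    (Finset.Icc 1 (t + 1)).filter p =
      if p (t + 1) then insert (t + 1) ((Finset.Icc 1 t).filter p)
      else (Finset.Icc 1 t).filter p := by
  rw [← Finset.insert_Icc_right_eq_Icc_add_one (by omega), Finset.filter_insert]

lemma count_succ (a : Fin M → ℕ → Finset (Fin N)) (i : Fin M) (j : Fin N) (t : ℕ) :
    count a i j (t + 1) = count a i j t + if j ∈ a i (t + 1) then 1 else 0 := by
  unfold count
  rw [filter_Icc_succ]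
  split_ifs with h
  · rw [Finset.card_insert_of_notMem (by simp)]
  · simp

lemma count_le (a : Fin M → ℕ → Finset (Fin N)) (i : Fin M) (j : Fin N) (t : ℕ) :
    count a i j t ≤ t := by
  simpa [count] using Finset.card_filter_le (Finset.Icc 1 t) (fun m => j ∈ a i m)

/-- The centred sum of the rewards that user `i` collected from option `j` up to step `t`. -/
def deviation (a : Fin M → ℕ → Finset (Fin N)) (x : Fin M → Fin N → ℕ → ℝ) (μ : ℝ)
    (i : Fin M) (j : Fin N) (t : ℕ) : ℝ :=
  ∑ m ∈ (Finset.Icc 1 t).filter (fun m => j ∈ a i m), (x i j m - μ)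

lemma deviation_succ (a : Fin M → ℕ → Finset (Fin N)) (x : Fin M → Fin N → ℕ → ℝ) (μ : ℝ)
    (i : Fin M) (j : Fin N) (t : ℕ) :
    deviation a x μ i j (t + 1) =
      deviation a x μ i j t + if j ∈ a i (t + 1) then x i j (t + 1) - μ else 0 := by
  unfold deviation
  rw [filter_Icc_succ]
  split_ifs with h
  · rw [Finset.sum_insert (by simp)]
    ring
  · simp

lemma deviation_eq (a : Fin M → ℕ → Finset (Fin N)) (x : Fin M → Fin N → ℕ → ℝ) (μ : ℝ)
    (i : Fin M) (j : Fin N) (t : ℕ) (h : count a i j t ≠ 0) :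
    deviation a x μ i j t = count a i j t * (sampleMean a x i j t - μ) := by
  have h' : (count a i j t : ℝ) ≠ 0 := by exact_mod_cast h
  unfold deviation sampleMean
  rw [Finset.sum_sub_distrib, mul_sub, mul_div_cancel₀ _ h']
  simp [count]

/-! ### Concentration of sample means under adaptive sampling -/

section Concentration

variable {Ω : Type*} {mΩ : MeasurableSpace Ω} {S : DiverseSetting M N K G} {α : ℝ}
  {disc : Fin M → Fin M → Fin G → Fin G → ℝ} {P : Measure Ω} {ℱ : Filtration ℕ mΩ}
  {X : Fin M → Fin N → ℕ → Ω → ℝ} {a : Fin M → ℕ → Ω → Finset (Fin N)} {g : Fin M → ℕ → Ω → Fin G}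

lemma IsDPartRun.measurableSet_mem (hr : IsDPartRun S α disc ℱ X a g) (i : Fin M) (j : Fin N)
    (t : ℕ) : MeasurableSet[ℱ t] {ω | j ∈ a i (t + 1) ω} := by
  have : {ω | j ∈ a i (t + 1) ω} =
      ⋃ A ∈ {A : Finset (Fin N) | j ∈ A}, {ω | a i (t + 1) ω = A} := by
    ext ω; simp
  rw [this]
  exact MeasurableSet.biUnion (Set.to_countable _) fun A _ => hr.measurable_choice i t A

lemma IsDPartRun.measurable_count (hr : IsDPartRun S α disc ℱ X a g) (i : Fin M) (j : Fin N)
    (t : ℕ) : Measurable[ℱ t] (fun ω => (count (fun k m => a k m ω) i j t : ℝ)) := by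
  induction t with
  | zero => simp only [count_zero]; exact measurable_const
  | succ t ih =>
    simp only [count_succ, Nat.cast_add, Nat.cast_ite, Nat.cast_one, Nat.cast_zero]
    refine (ih.mono (ℱ.mono t.le_succ) le_rfl).add (Measurable.ite ?_ measurable_const
      measurable_const)
    exact ℱ.mono t.le_succ _ (hr.measurableSet_mem i j t)

lemma IsDPartRun.measurable_deviation (hr : IsDPartRun S α disc ℱ X a g)
    (hX : IsRewardProcess S P ℱ X) (μ : ℝ) (i : Fin M) (j : Fin N) (t : ℕ) :
    Measurable[ℱ t]
      (fun ω => deviation (fun k m => a k m ω) (fun k j m => X k j m ω) μ i j t) := by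
  induction t with
  | zero => simp only [deviation]; simp
  | succ t ih =>
    simp only [deviation_succ]
    refine (ih.mono (ℱ.mono t.le_succ) le_rfl).add (Measurable.ite ?_
      ((hX.measurable i j _ (by omega)).sub_const _) measurable_const)
    exact ℱ.mono t.le_succ _ (hr.measurableSet_mem i j t)

/-- Hoeffding's lemma: a variable in [0,1] is sub-Gaussian with variance proxy 1/4, which produces
l²/8. -/
lemma IsRewardProcess.lintegral_exp_le [IsProbabilityMeasure P] (hX : IsRewardProcess S P ℱ X)
    (i : Fin M) (j : Fin N) (t : ℕ) (ht : 1 ≤ t) (l : ℝ) :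
    ∫⁻ ω, ENNReal.ofReal (Real.exp (l * (X i j t ω - S.mean i j) - l ^ 2 / 8)) ∂P ≤ 1 := by
  have hm : ∫ ω, X i j t ω ∂P = S.mean i j :=
    (hX.identDistrib i j t ht).integral_eq.trans (hX.mean_eq i j)
  have hs := hasSubgaussianMGF_of_mem_Icc
    ((hX.measurable i j t ht).mono (ℱ.le t) le_rfl).aemeasurable (hX.mem_Icc i j t ht)
  rw [hm] at hs
  have hle := hs.mgf_le l
  have hint := hs.integrable_exp_mul l
  simp only [sub_eq_add_neg _ (l ^ 2 / 8), Real.exp_add]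
  rw [← ofReal_integral_eq_lintegral_ofReal (hint.mul_const _)
    (Filter.Eventually.of_forall fun ω => by positivity), integral_mul_const,
    ENNReal.ofReal_le_one]
  refine (mul_le_mul_of_nonneg_right hle (Real.exp_pos _).le).trans ?_
  rw [← Real.exp_add]
  simp
  nlinarith

/-- The exponential supermartingale of the centred rewards has mean at most one. -/
lemma lintegral_exp_deviation_le [IsProbabilityMeasure P] (hX : IsRewardProcess S P ℱ X)
    (hr : IsDPartRun S α disc ℱ X a g) (i : Fin M) (j : Fin N) (l : ℝ) (t : ℕ) :
    ∫⁻ ω, ENNReal.ofReal (Real.exp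
      (l * deviation (fun k m => a k m ω) (fun k j m => X k j m ω) (S.mean i j) i j t
        - l ^ 2 / 8 * count (fun k m => a k m ω) i j t)) ∂P ≤ 1 := by
  induction t with
  | zero => simp [deviation, count_zero]
  | succ t ih =>
    set Z : Ω → ENNReal := fun ω => ENNReal.ofReal (Real.exp
      (l * deviation (fun k m => a k m ω) (fun k j m => X k j m ω) (S.mean i j) i j t
        - l ^ 2 / 8 * count (fun k m => a k m ω) i j t)) with hZ
    set Y : Ω → ENNReal := fun ω =>
      ENNReal.ofReal (Real.exp (l * (X i j (t + 1) ω - S.mean i j) - l ^ 2 / 8)) with hY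
    set A : Set Ω := {ω | j ∈ a i (t + 1) ω} with hA
    have hAm : MeasurableSet[ℱ t] A := hr.measurableSet_mem i j t
    have hZm : Measurable[ℱ t] Z := by
      refine ENNReal.measurable_ofReal.comp (Real.measurable_exp.comp ?_)
      exact ((hr.measurable_deviation hX _ i j t).const_mul l).sub
        ((hr.measurable_count i j t).const_mul _)
    have hYm : Measurable[MeasurableSpace.comap (fun ω i j => X i j (t + 1) ω) inferInstance] Y := by
      have h1 : Measurable (fun v : Fin M → Fin N → ℝ =>
          ENNReal.ofReal (Real.exp (l * (v i j - S.mean i j) - l ^ 2 / 8))) := by fun_prop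
      exact h1.comp (comap_measurable _)
    have hle : MeasurableSpace.comap (fun ω i j => X i j (t + 1) ω) inferInstance ≤ mΩ := by
      rw [← measurable_iff_comap_le]
      refine measurable_pi_iff.2 fun i => measurable_pi_iff.2 fun j => ?_
      exact (hX.measurable i j (t + 1) (by omega)).mono (ℱ.le _) le_rfl
    have hZA : Measurable[ℱ t] (A.indicator Z) := hZm.indicator hAm
    have hprod := lintegral_mul_eq_lintegral_mul_lintegral_of_independent_measurableSpace
      (ℱ.le t) hle (hX.indep t).symm hZA hYm
    have hAm' := ℱ.le t _ hAm
    have hZm' : Measurable Z := hZm.mono (ℱ.le t) le_rfl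
    -- Off `A` nothing is added; on `A` the new factor `Y` is independent of the past and has mean
    -- at most 1.
    calc _ = ∫⁻ ω, (Aᶜ.indicator Z ω + A.indicator Z ω * Y ω) ∂P := by
            refine lintegral_congr fun ω => ?_
            by_cases h : j ∈ a i (t + 1) ω
            · have h1 : ω ∈ A := h
              simp only [deviation_succ, count_succ, h, if_true, Set.indicator_of_mem h1,
                Set.indicator_of_notMem (Set.notMem_compl_iff.2 h1), zero_add, hZ, hY]
              rw [← ENNReal.ofReal_mul (Real.exp_pos _).le, ← Real.exp_add]
              push_cast
              congr 2
              ring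
            · have h1 : ω ∉ A := h
              simp only [deviation_succ, count_succ, h, if_false, Set.indicator_of_notMem h1,
                Set.indicator_of_mem (Set.mem_compl h1), zero_mul, add_zero, hZ]
      _ = ∫⁻ ω, Aᶜ.indicator Z ω ∂P + (∫⁻ ω, A.indicator Z ω ∂P) * ∫⁻ ω, Y ω ∂P := by
            rw [lintegral_add_left (hZm'.indicator hAm'.compl), hprod]
      _ ≤ ∫⁻ ω, Aᶜ.indicator Z ω ∂P + (∫⁻ ω, A.indicator Z ω ∂P) * 1 := by
            gcongr
            exact hX.lintegral_exp_le i j (t + 1) (by omega) l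
      _ = ∫⁻ ω, Z ω ∂P := by
            rw [mul_one, lintegral_indicator hAm'.compl, lintegral_indicator hAm', add_comm,
              lintegral_add_compl Z hAm']
      _ ≤ 1 := ih

/-- User `i` has tried option `j` by step `t`, and its sample mean is off by at least the
confidence radius. -/
def badEvent (S : DiverseSetting M N K G) (X : Fin M → Fin N → ℕ → Ω → ℝ)
    (a : Fin M → ℕ → Ω → Finset (Fin N)) (i : Fin M) (j : Fin N) (t : ℕ) : Set Ω :=
  {ω | 1 ≤ count (fun k m => a k m ω) i j t ∧
    √(2 * count (fun k m => a k m ω) i j t * Real.log t) ≤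
      |deviation (fun k m => a k m ω) (fun k j m => X k j m ω) (S.mean i j) i j t|}

lemma measurableSet_badEvent (hX : IsRewardProcess S P ℱ X)
    (hr : IsDPartRun S α disc ℱ X a g) (i : Fin M) (j : Fin N) (t : ℕ) :
    MeasurableSet (badEvent S X a i j t) := by
  have hc := (hr.measurable_count i j t).mono (ℱ.le t) le_rfl
  have hd := (hr.measurable_deviation hX (S.mean i j) i j t).mono (ℱ.le t) le_rfl
  have h1 := measurableSet_le (measurable_const (a := (1 : ℝ))) hc
  simp only [Nat.one_le_cast] at h1
  exact h1.inter (measurableSet_le (by fun_prop) hd.abs)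

/-- Chernoff bound on the slice where the random count equals n, so that the exponent may be tuned
to n. The sign `e` = ±1 selects the tail. -/
lemma measureReal_count_eq_deviation_le [IsProbabilityMeasure P] (hX : IsRewardProcess S P ℱ X)
    (hr : IsDPartRun S α disc ℱ X a g) (i : Fin M) (j : Fin N) {t : ℕ} (ht : 1 ≤ t) {n : ℕ}
    (hn : 1 ≤ n) {e : ℝ} (he : e ^ 2 = 1) :
    P.real {ω | count (fun k m => a k m ω) i j t = n ∧
      √(2 * n * Real.log t) ≤
        e * deviation (fun k m => a k m ω) (fun k j m => X k j m ω) (S.mean i j) i j t} ≤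
      1 / (t : ℝ) ^ 4 := by
  have hlog : 0 ≤ Real.log t := Real.log_natCast_nonneg t
  have hn0 : (0 : ℝ) < n := by exact_mod_cast hn
  have ht0 : (0 : ℝ) < t := by exact_mod_cast ht
  -- Maximiser of l√(2n log t) − l²n/8; the maximum is 8 log t − 4 log t = 4 log t, hence t⁻⁴.
  set l : ℝ := 4 * √(2 * Real.log t / n) with hl
  have hl0 : 0 ≤ l := by positivity
  have hl2 : l ^ 2 = 32 * Real.log t / n := by
    rw [hl, mul_pow, Real.sq_sqrt (by positivity)]; ring
  have hls : l * √(2 * n * Real.log t) = 8 * Real.log t := by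
    rw [hl, mul_assoc, ← Real.sqrt_mul (by positivity),
      show 2 * Real.log t / n * (2 * n * Real.log t) = (2 * Real.log t) ^ 2 by field_simp,
      Real.sqrt_sq (by positivity)]
    ring
  have key := lintegral_exp_deviation_le hX hr i j (l * e) t
  have hmeas : Measurable fun ω => ENNReal.ofReal (Real.exp
      (l * e * deviation (fun k m => a k m ω) (fun k j m => X k j m ω) (S.mean i j) i j t
        - (l * e) ^ 2 / 8 * count (fun k m => a k m ω) i j t)) := by
    have hc := (hr.measurable_count i j t).mono (ℱ.le t) le_rfl
    have hd := (hr.measurable_deviation hX (S.mean i j) i j t).mono (ℱ.le t) le_rfl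
    fun_prop
  have hM := (mul_meas_ge_le_lintegral (μ := P) hmeas (ENNReal.ofReal ((t : ℝ) ^ 4))).trans key
  have hsub : {ω | count (fun k m => a k m ω) i j t = n ∧
      √(2 * n * Real.log t) ≤
        e * deviation (fun k m => a k m ω) (fun k j m => X k j m ω) (S.mean i j) i j t} ⊆
      {ω | ENNReal.ofReal ((t : ℝ) ^ 4) ≤ ENNReal.ofReal (Real.exp
      (l * e * deviation (fun k m => a k m ω) (fun k j m => X k j m ω) (S.mean i j) i j t
        - (l * e) ^ 2 / 8 * count (fun k m => a k m ω) i j t))} := by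
    rintro ω ⟨h1, h2⟩
    refine ENNReal.ofReal_le_ofReal ?_
    rw [h1, mul_pow, he, hl2]
    have h3 := mul_le_mul_of_nonneg_left h2 hl0
    rw [hls] at h3
    calc (t : ℝ) ^ 4 = Real.exp (4 * Real.log t) := by
          rw [mul_comm, Real.exp_mul, Real.exp_log ht0]; norm_cast
      _ ≤ _ := by
          apply Real.exp_le_exp.2
          have : 32 * Real.log t / n * 1 / 8 * n = 4 * Real.log t := by field_simp; ring
          rw [this, mul_assoc]
          linarith
  have hM' := (mul_le_mul_right (measure_mono (μ := P) hsub) _).trans hM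
  have hM2 := ENNReal.toReal_mono ENNReal.one_ne_top hM'
  rw [ENNReal.toReal_mul, ENNReal.toReal_ofReal (by positivity), ENNReal.toReal_one] at hM2
  rw [le_div_iff₀ (by positivity), mul_comm]
  exact hM2

/-- A union over the at most t values of the count and both tails turns t⁻⁴ into 2t⁻³. -/
lemma measureReal_badEvent_le [IsProbabilityMeasure P] (hX : IsRewardProcess S P ℱ X)
    (hr : IsDPartRun S α disc ℱ X a g) (i : Fin M) (j : Fin N) (t : ℕ) :
    P.real (badEvent S X a i j t) ≤ 2 * (1 / (t : ℝ) ^ 3) := by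
  rcases Nat.eq_zero_or_pos t with rfl | ht
  -- At time 0 the event is empty, and the right side is 0 because 1/0 = 0.
  · simp [badEvent, count_zero]
  let E : ℕ → ℝ → Set Ω := fun n e => {ω | count (fun k m => a k m ω) i j t = n ∧
      √(2 * n * Real.log t) ≤
        e * deviation (fun k m => a k m ω) (fun k j m => X k j m ω) (S.mean i j) i j t}
  have hsub : badEvent S X a i j t ⊆ ⋃ n ∈ Finset.Icc 1 t, (E n 1 ∪ E n (-1)) := by
    rintro ω ⟨h1, h2⟩
    simp only [Set.mem_iUnion]
    refine ⟨_, Finset.mem_Icc.2 ⟨h1, count_le _ i j t⟩, ?_⟩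
    rcases le_abs.1 h2 with h | h
    · exact Or.inl ⟨rfl, by simpa using h⟩
    · exact Or.inr ⟨rfl, by simpa using h⟩
  calc P.real (badEvent S X a i j t) ≤ P.real (⋃ n ∈ Finset.Icc 1 t, (E n 1 ∪ E n (-1))) :=
        measureReal_mono hsub (measure_ne_top _ _)
    _ ≤ ∑ n ∈ Finset.Icc 1 t, P.real (E n 1 ∪ E n (-1)) := measureReal_biUnion_finset_le _ _
    _ ≤ ∑ n ∈ Finset.Icc 1 t, 2 * (1 / (t : ℝ) ^ 4) := by
        refine Finset.sum_le_sum fun n hn => (measureReal_union_le _ _).trans ?_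
        have hn1 := (Finset.mem_Icc.1 hn).1
        have h1 := measureReal_count_eq_deviation_le hX hr i j ht hn1 (e := 1) (by norm_num)
        have h2 := measureReal_count_eq_deviation_le hX hr i j ht hn1 (e := -1) (by norm_num)
        rw [two_mul]
        exact add_le_add h1 h2
    _ = 2 * (1 / (t : ℝ) ^ 3) := by
        simp
        field_simp

end Concentration

/-! ### Pathwise analysis of choices and classification -/

lemma recommendation_nonneg (disc : Fin M → Fin M → Fin G → Fin G → ℝ)
    (a : Fin M → ℕ → Finset (Fin N)) (g : Fin M → Fin G) (i : Fin M) (j : Fin N) (t : ℕ) :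
    0 ≤ recommendation disc a g i j t :=
  div_nonneg (Finset.sum_nonneg fun _ _ => by positivity)
    (Finset.sum_nonneg fun _ _ => Finset.sum_nonneg fun _ _ => by positivity)

lemma recommendation_le_one (disc : Fin M → Fin M → Fin G → Fin G → ℝ)
    (a : Fin M → ℕ → Finset (Fin N)) (g : Fin M → Fin G) (i : Fin M) (j : Fin N) (t : ℕ) :
    recommendation disc a g i j t ≤ 1 := by
  refine div_le_one_of_le₀ ?_ (Finset.sum_nonneg fun _ _ => Finset.sum_nonneg fun _ _ =>
    by positivity)
  exact Finset.single_le_sum (f := fun m => ∑ k, (count a k m t : ℝ) ^ weight disc g i k)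
    (fun _ _ => Finset.sum_nonneg fun _ _ => by positivity) (Finset.mem_univ j)

/-- If a `K`-element set contains an element outside `A`, with `A` of size `K`, it misses one of
`A`. -/
lemma exists_mem_notMem_of_card_eq {ι : Type*} {A B : Finset ι} (h : A.card = B.card)
    (hne : A ≠ B) : ∃ x ∈ A, x ∉ B := by
  by_contra! hc
  exact hne (Finset.eq_of_subset_of_card_le hc h.ge)

/-- A step that omits `y` ∈ `A` chooses K options other than `A`, hence at least one outside `A`. -/
lemma le_count_add_sum_count {a : Fin M → ℕ → Finset (Fin N)} {i : Fin M}
    (ha : ∀ m, (a i (m + 1)).card = K) {A : Finset (Fin N)} (hA : A.card = K) {y : Fin N}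
    (hy : y ∈ A) (t : ℕ) : t ≤ count a i y t + ∑ z ∈ Aᶜ, count a i z t := by
  induction t with
  | zero => simp
  | succ t ih =>
    simp only [count_succ, Finset.sum_add_distrib]
    by_cases h : y ∈ a i (t + 1)
    · simp only [h, if_true]
      omega
    · obtain ⟨z, hz, hzA⟩ := exists_mem_notMem_of_card_eq ((ha t).trans hA.symm)
        (fun e => h (e ▸ hy))
      have : 1 ≤ ∑ z ∈ Aᶜ, if z ∈ a i (t + 1) then 1 else 0 := by
        have := Finset.single_le_sum (f := fun z => if z ∈ a i (t + 1) then 1 else 0)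
          (fun _ _ => Nat.zero_le _) (Finset.mem_compl.2 hzA)
        simpa [hz] using this
      omega

/-- A misclassified user has spent at least half of its steps on choosing wrong options. -/
lemma le_two_mul_sum_count_of_ne (S : DiverseSetting M N K G) {a : Fin M → ℕ → Finset (Fin N)}
    {i : Fin M} (ha : ∀ m, (a i (m + 1)).card = K) {t : ℕ} {l r : Fin G}
    (hl : IsAssignedGroup S (fun j => count a i j t) l) (hne : l ≠ r) :
    t ≤ 2 * ∑ z ∈ (S.pref r)ᶜ, count a i z t := by
  obtain ⟨T, ⟨hTK, hT⟩, hmax⟩ := hl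
  -- If `T` were the preferred set of `r`, maximal overlap would force `l` to have the same set, so
  -- `l = r`.
  have hTne : T ≠ S.pref r := by
    rintro rfl
    have h1 := hmax r
    rw [Finset.inter_self] at h1
    have h2 : S.pref r ⊆ S.pref l := Finset.inter_eq_left.1
      (Finset.eq_of_subset_of_card_le Finset.inter_subset_left h1)
    exact hne (S.pref_injective
      (Finset.eq_of_subset_of_card_le h2 (by rw [S.pref_card, S.pref_card])).symm)
  obtain ⟨x, hxT, hx⟩ := exists_mem_notMem_of_card_eq (hTK.trans (S.pref_card r).symm) hTne
  obtain ⟨y, hy, hyT⟩ := exists_mem_notMem_of_card_eq ((S.pref_card r).trans hTK.symm) hTne.symm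
  have h1 := le_count_add_sum_count ha (S.pref_card r) hy t
  have h2 := hT x hxT y hyT
  have h3 := Finset.single_le_sum (f := fun z => count a i z t)
    (fun _ _ => Nat.zero_le _) (Finset.mem_compl.2 hx)
  simp only at h2 h3
  omega

/-- A wrong option that was tried often enough is chosen only if the sample mean of some option
deviates by its confidence radius. -/
lemma exists_deviation_of_mem {a : Fin M → ℕ → Finset (Fin N)}
    {x : Fin M → Fin N → ℕ → ℝ} {g : Fin M → Fin G} {i : Fin M} {t : ℕ} {α δ : ℝ}
    {disc : Fin M → Fin M → Fin G → Fin G → ℝ} {μ : Fin N → ℝ} {A B : Finset (Fin N)}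
    (hδ : 0 < δ) (hgap : ∀ z ∉ A, ∀ y ∈ A, μ z + 4 * δ < μ y)
    (hA : A.card = K) (hB : IsTopK K (dPartIndex α disc a x g i t) B)
    (hpert : |α| * √(Real.log t / t) ≤ δ) {z : Fin N} (hz : z ∈ B) (hzA : z ∉ A)
    (hn : 1 ≤ count a i z t) (hL : 2 * Real.log t ≤ δ ^ 2 * count a i z t) :
    ∃ y, 1 ≤ count a i y t ∧
      √(2 * count a i y t * Real.log t) ≤ |deviation a x (μ y) i y t| := by
  by_contra! hgood
  obtain ⟨y, hy, hyB⟩ := exists_mem_notMem_of_card_eq (hA.trans hB.1.symm)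
    (fun e => hzA (e ▸ hz))
  have hidx := hB.2 z hz y hyB
  have hz0 : count a i z t ≠ 0 := by omega
  -- An untried `y` has index ⊤ and could not lose to `z`.
  have hy0 : count a i y t ≠ 0 := by
    intro h0
    simp only [dPartIndex, h0, hz0, if_true, if_false, top_le_iff] at hidx
    exact EReal.coe_ne_top _ hidx
  have hmean : ∀ w, count a i w t ≠ 0 →
      |sampleMean a x i w t - μ w| < √(2 * Real.log t / count a i w t) := by
    intro w hw
    have h1 := hgood w (by omega)
    have hw' : (0 : ℝ) < count a i w t := by exact_mod_cast Nat.pos_of_ne_zero hw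
    rw [deviation_eq _ _ _ _ _ _ hw, abs_mul, abs_of_pos hw',
      show 2 * (count a i w t : ℝ) * Real.log t =
        (count a i w t : ℝ) ^ 2 * (2 * Real.log t / count a i w t) by field_simp,
      Real.sqrt_mul (by positivity), Real.sqrt_sq hw'.le] at h1
    exact lt_of_mul_lt_mul_left h1 hw'.le
  have hper : ∀ w, |α * (1 - recommendation disc a g i w t) * √(Real.log t / t)| ≤ δ := by
    intro w
    rw [abs_mul, abs_mul, abs_of_nonneg (Real.sqrt_nonneg _),
      abs_of_nonneg (sub_nonneg.2 (recommendation_le_one disc a g i w t))]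
    refine le_trans ?_ hpert
    gcongr
    refine mul_le_of_le_one_right (abs_nonneg _) ?_
    linarith [recommendation_nonneg disc a g i w t]
  have hrad : √(2 * Real.log t / count a i z t) ≤ δ := by
    rw [Real.sqrt_le_left hδ.le, div_le_iff₀ (by exact_mod_cast hn)]
    exact hL
  simp only [dPartIndex, hy0, hz0, if_false, EReal.coe_le_coe_iff] at hidx
  have h1 := abs_lt.1 (hmean z hz0)
  have h2 := abs_lt.1 (hmean y hy0)
  have h3 := abs_le.1 (hper z)
  have h4 := abs_le.1 (hper y)
  -- The index of `z` is below μ z + 3δ (error, bonus, perturbation), that of `y` above μ y − δ,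
  -- since its bonus covers its error. Hence the gap 4δ.
  have h5 := hgap z hzA y hy
  linarith [h1.1, h1.2, h2.1, h2.2, h3.1, h3.2, h4.1, h4.2]

/-- If `j` is chosen at step `s + 1` only when `s < s₀`, or `j` was chosen fewer than `L` times, or
`1 ≤ b s`, then it is chosen at most `s₀ + L + ∑ b` times. -/
lemma count_le_add_sum {a : Fin M → ℕ → Finset (Fin N)} {i : Fin M} {j : Fin N} {b : ℕ → ℝ}
    (hb : ∀ s, 0 ≤ b s) {s₀ L T : ℕ}
    (h : ∀ s < T, s₀ ≤ s → L ≤ count a i j s → j ∈ a i (s + 1) → 1 ≤ b s) :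
    ∀ t ≤ T, (count a i j t : ℝ) ≤ s₀ + L + ∑ s ∈ Finset.range t, b s := by
  intro t
  induction t with
  | zero => intro _; rw [count_zero]; simp; positivity
  | succ t ih =>
    intro ht
    have ih' := ih (by omega)
    have hsum : 0 ≤ ∑ s ∈ Finset.range (t + 1), b s := Finset.sum_nonneg fun s _ => hb s
    by_cases hs : t < s₀
    · have : (count a i j (t + 1) : ℝ) ≤ s₀ := by
        exact_mod_cast (count_le a i j (t + 1)).trans hs
      linarith [(Nat.cast_nonneg L : (0 : ℝ) ≤ L)]
    by_cases hc : count a i j t < L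
    · have : (count a i j (t + 1) : ℝ) ≤ L := by
        have : count a i j (t + 1) ≤ L := by rw [count_succ]; split_ifs <;> omega
        exact_mod_cast this
      linarith [(Nat.cast_nonneg s₀ : (0 : ℝ) ≤ s₀)]
    rw [Finset.sum_range_succ, count_succ]
    split_ifs with hj
    · have := h t (by omega) (by omega) (by omega) hj
      push_cast
      linarith
    · have := hb t
      push_cast
      linarith

/-! ### Choice of constants and the probability bound -/

lemma DiverseSetting.exists_gap (S : DiverseSetting M N K G) :
    ∃ δ : ℝ, 0 < δ ∧ ∀ i, ∀ z ∉ S.pref (S.group i), ∀ y ∈ S.pref (S.group i),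
      S.mean i z + 4 * δ < S.mean i y := by
  have h : ∀ᶠ δ : ℝ in nhdsWithin 0 (Set.Ioi 0), ∀ i z y, z ∉ S.pref (S.group i) →
      y ∈ S.pref (S.group i) → S.mean i z + 4 * δ < S.mean i y := by
    simp only [Filter.eventually_all]
    intro i z y hz hy
    have hlt : S.mean i z < S.mean i y := lt_of_le_of_ne ((S.isTopK_pref i).2 y hy z hz)
      fun e => hz ((S.mean_injective i e) ▸ hy)
    have hc : Filter.Tendsto (fun δ : ℝ => S.mean i z + 4 * δ) (nhdsWithin 0 (Set.Ioi 0))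
        (nhds (S.mean i z)) := by
      have : Continuous fun δ : ℝ => S.mean i z + 4 * δ := by fun_prop
      exact (this.tendsto' 0 _ (by simp)).mono_left nhdsWithin_le_nhds
    exact hc.eventually_lt_const hlt
  obtain ⟨δ, h1, h2⟩ := (h.and self_mem_nhdsWithin).exists
  exact ⟨δ, h2, fun i z hz y hy => h1 i z y hz hy⟩

lemma exists_forall_mul_sqrt_log_div_le (c : ℝ) {δ : ℝ} (hδ : 0 < δ) :
    ∃ s₀ : ℕ, ∀ s ≥ s₀, c * √(Real.log s / s) ≤ δ := by
  have h1 : Filter.Tendsto (fun s : ℕ => Real.log s / s) Filter.atTop (nhds 0) :=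
    (Real.isLittleO_log_id_atTop.tendsto_div_nhds_zero).comp tendsto_natCast_atTop_atTop
  have h2 : Filter.Tendsto (fun s : ℕ => c * √(Real.log s / s)) Filter.atTop (nhds 0) := by
    simpa using (h1.sqrt).const_mul c
  exact Filter.eventually_atTop.1 (h2.eventually_le_const hδ)

/-- A misclassification forces many deviations of sample means. -/
lemma le_of_class_ne {Ω : Type*} {mΩ : MeasurableSpace Ω} {S : DiverseSetting M N K G} {α : ℝ}
    {disc : Fin M → Fin M → Fin G → Fin G → ℝ} {ℱ : Filtration ℕ mΩ}
    {X : Fin M → Fin N → ℕ → Ω → ℝ} {a : Fin M → ℕ → Ω → Finset (Fin N)}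
    {g : Fin M → ℕ → Ω → Fin G} (hr : IsDPartRun S α disc ℱ X a g) {δ : ℝ} (hδ : 0 < δ)
    (hgap : ∀ i, ∀ z ∉ S.pref (S.group i), ∀ y ∈ S.pref (S.group i),
      S.mean i z + 4 * δ < S.mean i y)
    {s₀ : ℕ} (hs₀ : ∀ s ≥ s₀, |α| * √(Real.log s / s) ≤ δ) {L t : ℕ} (hL1 : 1 ≤ L)
    (hL : 2 * Real.log t ≤ δ ^ 2 * L) (i : Fin M) {ω : Ω} (hω : g i t ω ≠ S.group i) :
    (t : ℝ) ≤ 2 * N * (s₀ + L + ∑ s ∈ Finset.range t, ∑ y,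
      (badEvent S X a i y s).indicator (fun _ => (1 : ℝ)) ω) := by
  set b : ℕ → ℝ := fun s => ∑ y, (badEvent S X a i y s).indicator (fun _ => (1 : ℝ)) ω with hb
  have hind : ∀ s y, 0 ≤ (badEvent S X a i y s).indicator (fun _ => (1 : ℝ)) ω :=
    fun s y => Set.indicator_nonneg (fun _ _ => zero_le_one) _
  have hb0 : ∀ s, 0 ≤ b s := fun s => Finset.sum_nonneg fun y _ => hind s y
  have h1 := le_two_mul_sum_count_of_ne S (fun m => (hr.choice i m ω).1) (hr.classify i t ω) hω
  have h2 : ∀ z ∈ (S.pref (S.group i))ᶜ, (count (fun k m => a k m ω) i z t : ℝ) ≤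
      s₀ + L + ∑ s ∈ Finset.range t, b s := by
    intro z hz
    refine count_le_add_sum hb0 (T := t) (fun s hst hs hc hzs => ?_) t le_rfl
    have hs0 : 0 < s := by
      rcases Nat.eq_zero_or_pos s with rfl | h
      · rw [count_zero] at hc; omega
      · exact h
    -- The threshold `L`, fixed by the final time `t`, thus serves every earlier `s`.
    have hlog : Real.log s ≤ Real.log t :=
      Real.log_le_log (by exact_mod_cast hs0) (by exact_mod_cast hst.le)
    have hLc : δ ^ 2 * (L : ℝ) ≤ δ ^ 2 * count (fun k m => a k m ω) i z s := by
      gcongr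
    obtain ⟨y, hy⟩ := exists_deviation_of_mem (μ := S.mean i) hδ (hgap i) (S.pref_card _)
      (hr.choice i s ω) (hs₀ s hs) hzs (Finset.mem_compl.1 hz) (hL1.trans hc) (by linarith)
    have hyb : ω ∈ badEvent S X a i y s := hy
    calc (1 : ℝ) = (badEvent S X a i y s).indicator (fun _ => (1 : ℝ)) ω := by
          rw [Set.indicator_of_mem hyb]
      _ ≤ b s := Finset.single_le_sum
          (f := fun y => (badEvent S X a i y s).indicator (fun _ => (1 : ℝ)) ω)
          (fun y _ => hind s y) (Finset.mem_univ y)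
  have h3 := Finset.sum_le_card_nsmul _ _ _ h2
  have hcard : (((S.pref (S.group i))ᶜ.card : ℕ) : ℝ) ≤ N := by
    exact_mod_cast (Finset.card_le_univ _).trans (by simp)
  have hR : (0 : ℝ) ≤ s₀ + L + ∑ s ∈ Finset.range t, b s := by
    have := Finset.sum_nonneg fun s (_ : s ∈ Finset.range t) => hb0 s
    positivity
  rw [nsmul_eq_mul] at h3
  have h4 := mul_le_mul_of_nonneg_right hcard hR
  have h5 : (t : ℝ) ≤ 2 * ∑ z ∈ (S.pref (S.group i))ᶜ, (count (fun k m => a k m ω) i z t : ℝ) := by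
    exact_mod_cast h1
  linarith

/-- Markov's inequality applied to the bound of `le_of_class_ne`; its random part has mean bounded
uniformly in `t`. -/
lemma measureReal_class_ne_le {Ω : Type*} {mΩ : MeasurableSpace Ω} {S : DiverseSetting M N K G}
    {α : ℝ} {disc : Fin M → Fin M → Fin G → Fin G → ℝ} {P : Measure Ω} [IsProbabilityMeasure P]
    {ℱ : Filtration ℕ mΩ} {X : Fin M → Fin N → ℕ → Ω → ℝ}
    {a : Fin M → ℕ → Ω → Finset (Fin N)} {g : Fin M → ℕ → Ω → Fin G}
    (hX : IsRewardProcess S P ℱ X) (hr : IsDPartRun S α disc ℱ X a g) {δ : ℝ} (hδ : 0 < δ)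
    (hgap : ∀ i, ∀ z ∉ S.pref (S.group i), ∀ y ∈ S.pref (S.group i),
      S.mean i z + 4 * δ < S.mean i y)
    {s₀ : ℕ} (hs₀ : ∀ s ≥ s₀, |α| * √(Real.log s / s) ≤ δ) {L t : ℕ} (hL1 : 1 ≤ L)
    (hL : 2 * Real.log t ≤ δ ^ 2 * L) (i : Fin M) :
    t * P.real {ω | g i t ω ≠ S.group i} ≤
      2 * N * (s₀ + L + N * (2 * ∑' s : ℕ, 1 / (s : ℝ) ^ 3)) := by
  set F : Ω → ℝ := fun ω => 2 * N * (s₀ + L + ∑ s ∈ Finset.range t, ∑ y,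
      (badEvent S X a i y s).indicator (fun _ => (1 : ℝ)) ω) with hF
  have hi : ∀ s y, Integrable ((badEvent S X a i y s).indicator (fun _ => (1 : ℝ))) P :=
    fun s y => (integrable_const _).indicator (measurableSet_badEvent hX hr i y s)
  have hi2 : Integrable (fun ω => ∑ s ∈ Finset.range t, ∑ y,
      (badEvent S X a i y s).indicator (fun _ => (1 : ℝ)) ω) P :=
    integrable_finsetSum _ fun s _ => integrable_finsetSum _ fun y _ => hi s y
  have hF0 : 0 ≤ F := fun ω => by
    have : 0 ≤ ∑ s ∈ Finset.range t, ∑ y,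
        (badEvent S X a i y s).indicator (fun _ => (1 : ℝ)) ω :=
      Finset.sum_nonneg fun s _ => Finset.sum_nonneg fun y _ =>
        Set.indicator_nonneg (fun _ _ => zero_le_one) _
    simp only [hF, Pi.zero_apply]
    positivity
  have hFi : Integrable F P := ((integrable_const _).add hi2).const_mul _
  have hmarkov := mul_meas_ge_le_integral_of_nonneg (Filter.Eventually.of_forall hF0) hFi (t : ℝ)
  have hsub : P.real {ω | g i t ω ≠ S.group i} ≤ P.real {ω | (t : ℝ) ≤ F ω} :=
    measureReal_mono (fun ω hω => le_of_class_ne hr hδ hgap hs₀ hL1 hL i hω)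
  have hsum : ∫ ω, ∑ s ∈ Finset.range t, ∑ y,
      (badEvent S X a i y s).indicator (fun _ => (1 : ℝ)) ω ∂P ≤
      N * (2 * ∑' s : ℕ, 1 / (s : ℝ) ^ 3) := by
    rw [integral_finsetSum _ fun s _ => integrable_finsetSum _ fun y _ => hi s y]
    calc _ ≤ ∑ s ∈ Finset.range t, (N : ℝ) * (2 * (1 / (s : ℝ) ^ 3)) := by
          refine Finset.sum_le_sum fun s _ => ?_
          rw [integral_finsetSum _ fun y _ => hi s y]
          calc _ ≤ ∑ _y : Fin N, (2 : ℝ) * (1 / (s : ℝ) ^ 3) := by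
                refine Finset.sum_le_sum fun y _ => ?_
                rw [integral_indicator_const _ (measurableSet_badEvent hX hr i y s)]
                simpa using measureReal_badEvent_le hX hr i y s
            _ = _ := by simp
      _ = (N : ℝ) * (2 * ∑ s ∈ Finset.range t, 1 / (s : ℝ) ^ 3) := by
          rw [Finset.mul_sum, Finset.mul_sum]
      _ ≤ _ := by
          gcongr
          exact (Real.summable_one_div_nat_pow.2 (by norm_num)).sum_le_tsum _
            fun s _ => by positivity
  calc t * P.real {ω | g i t ω ≠ S.group i} ≤ t * P.real {ω | (t : ℝ) ≤ F ω} := by gcongr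
    _ ≤ ∫ ω, F ω ∂P := hmarkov
    _ = 2 * N * (s₀ + L + ∫ ω, ∑ s ∈ Finset.range t, ∑ y,
          (badEvent S X a i y s).indicator (fun _ => (1 : ℝ)) ω ∂P) := by
        rw [hF, integral_const_mul, integral_add (integrable_const _) hi2]
        simp
    _ ≤ _ := by gcongr

end GroupLearning

theorem mainTheorem4 {M N K G : ℕ} (S : GroupLearning.DiverseSetting M N K G)
    (α : ℝ) (disc : Fin M → Fin M → Fin G → Fin G → ℝ)
    (hdisc : ∀ i k l l', disc i k l l' < 1) :
    ∃ C₁ : ℝ, 0 < C₁ ∧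
      ∀ (Ω : Type*) (mΩ : MeasurableSpace Ω) (P : Measure Ω) (_ : IsProbabilityMeasure P)
        (ℱ : Filtration ℕ mΩ) (X : Fin M → Fin N → ℕ → Ω → ℝ)
        (a : Fin M → ℕ → Ω → Finset (Fin N)) (g : Fin M → ℕ → Ω → Fin G),
        GroupLearning.IsRewardProcess S P ℱ X →
        GroupLearning.IsDPartRun S α disc ℱ X a g →
        ∀ (j : Fin M) (r : Fin G), S.group j = r →
          ∀ t : ℕ, 2 ≤ t →
            P.real {ω | g j t ω ≠ r} ≤ C₁ * (Real.log t / t) := by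
  obtain ⟨δ, hδ, hgap⟩ := S.exists_gap
  obtain ⟨s₀, hs₀⟩ := GroupLearning.exists_forall_mul_sqrt_log_div_le |α| hδ
  -- The 2 absorbs the rounding and the `+ 1` in `L`.
  set c : ℝ := s₀ + 2 + N * (2 * ∑' s : ℕ, 1 / (s : ℝ) ^ 3) with hc
  have hc0 : 0 ≤ c := by
    have : 0 ≤ ∑' s : ℕ, 1 / (s : ℝ) ^ 3 := tsum_nonneg fun s => by positivity
    positivity
  have hl2 : 0 < Real.log 2 := Real.log_pos one_lt_two
  -- Since t ≥ 2, the constant `c` is at most (c / log 2) log t; the `+ 1` keeps the value positive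
  -- when N = 0.
  refine ⟨2 * N * (2 / δ ^ 2 + c / Real.log 2) + 1, by positivity, ?_⟩
  rintro Ω mΩ P hP ℱ X a g hX hr j r rfl t ht
  have ht0 : (0 : ℝ) < t := by exact_mod_cast (by omega : 0 < t)
  have hlog : Real.log 2 ≤ Real.log t := Real.log_le_log two_pos (by exact_mod_cast ht)
  have hlog0 : 0 < Real.log t := hl2.trans_le hlog
  set L : ℕ := ⌈2 * Real.log t / δ ^ 2⌉₊ + 1 with hLdef
  have hL : 2 * Real.log t ≤ δ ^ 2 * L := by
    have h1 : 2 * Real.log t / δ ^ 2 ≤ L := by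
      rw [hLdef]; push_cast; linarith [Nat.le_ceil (2 * Real.log t / δ ^ 2)]
    rwa [div_le_iff₀' (by positivity)] at h1
  have hLle : (L : ℝ) ≤ 2 / δ ^ 2 * Real.log t + 2 := by
    have h1 := Nat.ceil_lt_add_one (a := 2 * Real.log t / δ ^ 2) (by positivity)
    rw [hLdef, div_mul_eq_mul_div]
    push_cast
    linarith
  have key := GroupLearning.measureReal_class_ne_le hX hr hδ hgap hs₀ (by omega) hL j
  have hcl : c ≤ c / Real.log 2 * Real.log t := by
    rw [div_mul_eq_mul_div, le_div_iff₀ hl2]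
    gcongr
  rw [mul_div_assoc', le_div_iff₀ ht0, mul_comm]
  refine key.trans ?_
  calc _ ≤ 2 * N * (2 / δ ^ 2 * Real.log t + c / Real.log 2 * Real.log t) := by
        refine mul_le_mul_of_nonneg_left ?_ (by positivity)
        linarith
    _ ≤ _ := by linarith
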